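/- Let $\mathbb O=\mathbb H\oplus\mathbb H$ be the octonions, with product $(q_1,q_2)(p_1,p_2)=(q_1p_1-\bar p_2q_2,\;p_2q_1+q_2\bar p_1)$, conjugation $\overline{(q_1,q_2)}=(\bar q_1,-q_2)$ and norm $|a|^2=\mathrm{Re}(a\bar a)$. Put $U_1=\{1\}\times\mathbb O\times\mathbb O$, $U_2=\mathbb O\times\{1\}\times\mathbb O$, $U_3=\mathbb O\times\mathbb O\times\{1\}$ and $\mathcal U=U_1\cup U_2\cup U_3\subset\mathbb O^3$. Let $\sim$ be the equivalence relation on $\mathcal U$ given by $(a,b,c)\sim(d,e,f)$ iff $a=d\mu,\ b=e\mu,\ c=f\mu$ for some $\mu\in\mathbb O\setminus\{0\}$. Let $\mathbb OP^2=\mathcal U/{\sim}$, with $[a,b,c]$ denoting the class of $(a,b,c)$, and let $U_i/{\sim}$ denote the image of $U_i$ in $\mathbb OP^2$. Equip $\mathbb OP^2$ with the real-analytic manifold structure given by the three charts $U_i/{\sim}\to\mathbb O^2=\mathbb R^{16}$, $[1,u,v]\mapsto(u,v)$, $[u,1,v]\mapsto(u,v)$, $[u,v,1]\mapsto(u,v)$,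 and with the Riemannian metric given in each of these charts by $$ds^2=\frac{|du|^2(1+|v|^2)+|dv|^2(1+|u|^2)-2\,\mathrm{Re}[(u\bar v)(dv\,d\bar u)]}{(1+|u|^2+|v|^2)^2}.$$ Let $r\in\mathbb R$ and $\lambda\in\mathbb O$ satisfy $r^2+|\lambda|^2=1$. Then: 1. The map $\mathcal R_{r,\lambda}:U_1/{\sim}\to U_1/{\sim}$, $[1,u,v]\mapsto[1,\;ru+\lambda v,\;\bar\lambda u-rv]$, is an isometry of $U_1/{\sim}$: a real-analytic diffeomorphism of $U_1/{\sim}$ onto itself that preserves $ds^2$. 2. There is exactly one real-analytic map $\widetilde{\mathcal R}_{r,\lambda}:\mathbb OP^2\to\mathbb OP^2$ that extends $\mathcal R_{r,\lambda}$. It is an involution, $\widetilde{\mathcal R}_{r,\lambda}\circ\widetilde{\mathcal R}_{r,\lambda}=\mathrm{id}$, and an isometry of $\mathbb OP^2$: a real-analytic diffeomorphism that preserves $ds^2$. -/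

import Mathlib

open scoped Quaternion Manifold ContDiff

noncomputable section

/-- The octonions: the real inner product space `ℍ ⊕ ℍ` (Euclidean norm), with the
Cayley-Dickson multiplication defined below. -/
def Octonion : Type := WithLp 2 (ℍ[ℝ] × ℍ[ℝ])

namespace Octonion

instance : NormedAddCommGroup Octonion := inferInstanceAs (NormedAddCommGroup (WithLp 2 (ℍ[ℝ] × ℍ[ℝ])))
instance : InnerProductSpace ℝ Octonion := inferInstanceAs (InnerProductSpace ℝ (WithLp 2 (ℍ[ℝ] × ℍ[ℝ])))

/-- The octonion `(q₁, q₂)`. -/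
def mk (q₁ q₂ : ℍ[ℝ]) : Octonion := WithLp.toLp 2 (q₁, q₂)

/-- First quaternionic component. -/
def left (a : Octonion) : ℍ[ℝ] := (WithLp.ofLp a).1

/-- Second quaternionic component. -/
def right (a : Octonion) : ℍ[ℝ] := (WithLp.ofLp a).2

@[simp] theorem left_mk (p q : ℍ[ℝ]) : (mk p q).left = p := rfl
@[simp] theorem right_mk (p q : ℍ[ℝ]) : (mk p q).right = q := rfl

/-- `(q₁,q₂)(p₁,p₂) = (q₁p₁ - p̄₂q₂, p₂q₁ + q₂p̄₁)`. -/
instance : Mul Octonion :=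
  ⟨fun a b => mk (a.left * b.left - star b.right * a.right) (b.right * a.left + a.right * star b.left)⟩

instance : One Octonion := ⟨mk 1 0⟩

/-- Octonionic conjugation `(q₁,q₂) ↦ (q̄₁,-q₂)`. -/
instance : Star Octonion := ⟨fun a => mk (star a.left) (-a.right)⟩

/-- `a⁻¹ = |a|⁻² ā` (so `0⁻¹ = 0`). -/
instance : Inv Octonion := ⟨fun a => (‖a‖ ^ 2)⁻¹ • star a⟩

/-- The real part. -/
def re (a : Octonion) : ℝ := a.left.re

@[ext] theorem ext {a b : Octonion} (h₁ : a.left = b.left) (h₂ : a.right = b.right) : a = b :=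
  (WithLp.ofLp_injective 2) (Prod.ext h₁ h₂)

@[simp] theorem left_add (a b : Octonion) : (a + b).left = a.left + b.left := rfl
@[simp] theorem right_add (a b : Octonion) : (a + b).right = a.right + b.right := rfl
@[simp] theorem left_sub (a b : Octonion) : (a - b).left = a.left - b.left := rfl
@[simp] theorem right_sub (a b : Octonion) : (a - b).right = a.right - b.right := rfl
@[simp] theorem left_neg (a : Octonion) : (-a).left = -a.left := rfl
@[simp] theorem right_neg (a : Octonion) : (-a).right = -a.right := rfl
@[simp] theorem left_smul (r : ℝ) (a : Octonion) : (r • a).left = r • a.left := rfl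
@[simp] theorem right_smul (r : ℝ) (a : Octonion) : (r • a).right = r • a.right := rfl
@[simp] theorem left_zero : (0 : Octonion).left = 0 := rfl
@[simp] theorem right_zero : (0 : Octonion).right = 0 := rfl
@[simp] theorem left_one : (1 : Octonion).left = 1 := rfl
@[simp] theorem right_one : (1 : Octonion).right = 0 := rfl
@[simp] theorem left_star (a : Octonion) : (star a).left = star a.left := rfl
@[simp] theorem right_star (a : Octonion) : (star a).right = -a.right := rfl
@[simp] theorem left_mul (a b : Octonion) :
    (a * b).left = a.left * b.left - star b.right * a.right := rfl
@[simp] theorem right_mul (a b : Octonion) :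
    (a * b).right = b.right * a.left + a.right * star b.left := rfl

theorem inv_def (a : Octonion) : a⁻¹ = (‖a‖ ^ 2)⁻¹ • star a := rfl

theorem norm_sq_eq (a : Octonion) : ‖a‖ ^ 2 = ‖a.left‖ ^ 2 + ‖a.right‖ ^ 2 :=
  WithLp.prod_norm_sq_eq_of_L2 (α := ℍ[ℝ]) (β := ℍ[ℝ]) a

theorem norm_sq_eq_sum (a : Octonion) : ‖a‖ ^ 2 =
    (a.left.re ^ 2 + a.left.imI ^ 2 + a.left.imJ ^ 2 + a.left.imK ^ 2) +
      (a.right.re ^ 2 + a.right.imI ^ 2 + a.right.imJ ^ 2 + a.right.imK ^ 2) := by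
  rw [norm_sq_eq]
  simp only [pow_two ‖_‖, ← Quaternion.normSq_eq_norm_mul_self, Quaternion.normSq_def']

/-- The inner product of `ℍ ⊕ ℍ` is `⟨a, b⟩ = Re (a b̄)`. -/
theorem inner_eq_re (a b : Octonion) : inner ℝ a b = (a * star b).re := by
  have h : inner ℝ a b = inner ℝ a.left b.left + inner ℝ a.right b.right :=
    WithLp.prod_inner_apply (𝕜 := ℝ) (E := ℍ[ℝ]) (F := ℍ[ℝ]) a b
  rw [h, Quaternion.inner_def, Quaternion.inner_def]
  simp [re]
  ring

instance : NonAssocRing Octonion :=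
  { (inferInstance : AddCommGroup Octonion) with
    mul := (· * ·)
    one := 1
    left_distrib := fun a b c => by ext1 <;> simp [mul_add, add_mul] <;> abel
    right_distrib := fun a b c => by ext1 <;> simp [mul_add, add_mul] <;> abel
    zero_mul := fun a => by ext1 <;> simp
    mul_zero := fun a => by ext1 <;> simp
    one_mul := fun a => by ext1 <;> simp
    mul_one := fun a => by ext1 <;> simp }

theorem smul_mul (r : ℝ) (a b : Octonion) : (r • a) * b = r • (a * b) := by
  ext1 <;> simp [smul_sub, smul_add]

theorem mul_smul (r : ℝ) (a b : Octonion) : a * (r • b) = r • (a * b) := by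
  ext1 <;> simp [smul_sub, smul_add]

theorem mul_mul_star (a b : Octonion) : (a * b) * star b = (‖b‖ ^ 2) • a := by
  rw [norm_sq_eq_sum]
  ext <;> simp <;> ring

theorem star_mul_mul (a b : Octonion) : star a * (a * b) = (‖a‖ ^ 2) • b := by
  rw [norm_sq_eq_sum]
  ext <;> simp <;> ring

theorem star_star' (a : Octonion) : star (star a) = a := by
  ext1 <;> simp

theorem norm_star' (a : Octonion) : ‖star a‖ ^ 2 = ‖a‖ ^ 2 := by
  rw [norm_sq_eq, norm_sq_eq]; simp

theorem norm_sq_ne {a : Octonion} (h : a ≠ 0) : ‖a‖ ^ 2 ≠ 0 := by simpa using h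

theorem mul_mul_inv (a : Octonion) {b : Octonion} (h : b ≠ 0) : (a * b) * b⁻¹ = a := by
  rw [inv_def, mul_smul, mul_mul_star, smul_smul, inv_mul_cancel₀ (norm_sq_ne h), one_smul]

theorem inv_mul_mul {a : Octonion} (h : a ≠ 0) (b : Octonion) : a⁻¹ * (a * b) = b := by
  rw [inv_def, smul_mul, star_mul_mul, smul_smul, inv_mul_cancel₀ (norm_sq_ne h), one_smul]

theorem mul_inv_mul (a : Octonion) {b : Octonion} (h : b ≠ 0) : (a * b⁻¹) * b = a := by
  have := mul_mul_star a (star b)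
  rw [star_star', norm_star'] at this
  rw [inv_def, mul_smul, smul_mul, this, smul_smul, inv_mul_cancel₀ (norm_sq_ne h), one_smul]

theorem one_ne_zero' : (1 : Octonion) ≠ 0 := fun h => by
  have := congrArg (fun a : Octonion => a.left.re) h
  simp at this

theorem mul_inv_self {a : Octonion} (h : a ≠ 0) : a * a⁻¹ = 1 := by
  simpa using mul_mul_inv 1 h

theorem inv_mul_self {a : Octonion} (h : a ≠ 0) : a⁻¹ * a = 1 := by
  simpa using mul_inv_mul 1 h

theorem inv_ne_zero' {a : Octonion} (h : a ≠ 0) : a⁻¹ ≠ 0 := fun h0 => by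
  have := mul_inv_self h
  rw [h0, mul_zero] at this
  exact one_ne_zero' this.symm

theorem mul_ne_zero' {a b : Octonion} (ha : a ≠ 0) (hb : b ≠ 0) : a * b ≠ 0 := fun h => by
  have := mul_mul_inv a hb
  rw [h, zero_mul] at this
  exact ha this.symm

theorem ne_zero_left {a b : Octonion} (h : a * b = 1) : a ≠ 0 := fun h0 => by
  rw [h0, zero_mul] at h; exact one_ne_zero' h.symm

theorem ne_zero_right {a b : Octonion} (h : a * b = 1) : b ≠ 0 := fun h0 => by
  rw [h0, mul_zero] at h; exact one_ne_zero' h.symm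

theorem eq_inv_of_mul_eq_one {a b : Octonion} (h : a * b = 1) : b = a⁻¹ := by
  have := inv_mul_mul (ne_zero_left h) b
  rw [h, mul_one] at this; exact this.symm

/-- Associativity of three octonions when one of the relevant products is trivial. -/
theorem assoc_of {x m l : Octonion} (hm : m ≠ 0) (hl : l ≠ 0)
    (h : x = 1 ∨ m = 1 ∨ l = 1 ∨ x * m = 1 ∨ m * l = 1 ∨ (x * m) * l = 1) :
    (x * m) * l = x * (m * l) := by
  rcases h with rfl | rfl | rfl | h | h | h
  · simp
  · simp
  · simp
  · have hx := ne_zero_left h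
    have : m = x⁻¹ := eq_inv_of_mul_eq_one h
    have h2 : x * (m * l) = l := by
      have h3 := star_mul_mul (star x) l
      rw [star_star', norm_star'] at h3
      rw [this, inv_def, smul_mul, mul_smul, h3, smul_smul, inv_mul_cancel₀ (norm_sq_ne hx), one_smul]
    rw [h, h2, one_mul]
  · rw [h, mul_one, eq_inv_of_mul_eq_one h, mul_mul_inv x hm]
  · have h1 : x * m = l⁻¹ := by
      have := mul_mul_inv (x * m) hl
      rw [h, one_mul] at this; exact this.symm
    have h2 : x = l⁻¹ * m⁻¹ := by rw [← h1, mul_mul_inv x hm]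
    have h3 : m * l ≠ 0 := mul_ne_zero' hm hl
    have h4 : star (m * l) = star l * star m := by
      ext <;> simp
    have h5 : ‖m * l‖ ^ 2 = ‖m‖ ^ 2 * ‖l‖ ^ 2 := by
      rw [norm_sq_eq_sum, norm_sq_eq_sum, norm_sq_eq_sum]; simp; ring
    have h6 : (m * l)⁻¹ = l⁻¹ * m⁻¹ := by
      rw [inv_def, inv_def, inv_def, smul_mul, mul_smul, smul_smul, h4, h5, mul_inv, mul_comm (‖m‖ ^ 2)⁻¹]
    rw [h, h2, ← h6, inv_mul_self h3]

end Octonion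

/-- The set `𝒰 = U₁ ∪ U₂ ∪ U₃ ⊆ 𝕆³` of reduced homogeneous coordinates: triples with some entry
equal to `1` (indices `0, 1, 2` stand for `1, 2, 3`). -/
abbrev ReducedTriple : Type := {x : Fin 3 → Octonion // ∃ i, x i = 1}

/-- `x ∼ y` if `x = y l` entrywise for some nonzero octonion `l`. -/
def ReducedTriple.Rel (x y : ReducedTriple) : Prop :=
  ∃ l : Octonion, l ≠ 0 ∧ ∀ k, x.1 k = y.1 k * l

theorem ReducedTriple.Rel.equivalence : Equivalence ReducedTriple.Rel where
  refl x := ⟨1, Octonion.one_ne_zero', fun k => (mul_one _).symm⟩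
  symm := by
    rintro x y ⟨l, hl, h⟩
    exact ⟨l⁻¹, Octonion.inv_ne_zero' hl, fun k => by rw [h k, Octonion.mul_mul_inv _ hl]⟩
  trans := by
    rintro ⟨x, k₀, hx⟩ ⟨y, j, hy⟩ ⟨z, i, hz⟩ ⟨l, hl, h⟩ ⟨m, hm, h'⟩
    simp only at h h'
    refine ⟨m * l, Octonion.mul_ne_zero' hm hl, fun k => ?_⟩
    show x k = z k * (m * l)
    have hxk : ∀ k, x k = (z k * m) * l := fun k => by rw [h k, h' k]
    rw [hxk k]
    apply Octonion.assoc_of hm hl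
    have key : k = i ∨ k = j ∨ k = k₀ ∨ i = j ∨ i = k₀ ∨ j = k₀ := by omega
    rcases key with rfl | rfl | rfl | rfl | rfl | rfl
    · exact Or.inl hz
    · right; right; right; left; rw [← h' k, hy]
    · right; right; right; right; right; rw [← hxk k, hx]
    · right; left
      have := h' i
      rw [hy, hz, one_mul] at this
      exact this.symm
    · right; right; right; right; left
      rw [← hx, hxk i, hz, one_mul]
    · right; right; left
      have := h j
      rw [hx, hy, one_mul] at this
      exact this.symm

instance ReducedTriple.setoid : Setoid ReducedTriple := ⟨ReducedTriple.Rel, ReducedTriple.Rel.equivalence⟩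

/-- The octonionic projective plane `𝕆P² = 𝒰/∼`. -/
def OP2 : Type := Quotient ReducedTriple.setoid

namespace OP2

open Octonion

/-- The model space `𝕆 × 𝕆 = ℝ¹⁶`. -/
abbrev Model : Type := Octonion × Octonion

/-- The triples `(1,u,v)`, `(u,1,v)`, `(u,v,1)` for `i = 0, 1, 2`. -/
def triple (i : Fin 3) (w : Model) : Fin 3 → Octonion :=
  match i with
  | 0 => ![1, w.1, w.2]
  | 1 => ![w.1, 1, w.2]
  | 2 => ![w.1, w.2, 1]

/-- The entries of a triple other than the `i`-th. -/
def entries (i : Fin 3) (x : Fin 3 → Octonion) : Model :=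
  match i with
  | 0 => (x 1, x 2)
  | 1 => (x 0, x 2)
  | 2 => (x 0, x 1)

theorem triple_self (i : Fin 3) (w : Model) : triple i w i = 1 := by
  fin_cases i <;> rfl

theorem entries_triple (i : Fin 3) (w : Model) : entries i (triple i w) = w := by
  fin_cases i <;> rfl

theorem triple_entries (i : Fin 3) (x : Fin 3 → Octonion) (h : x i = 1) :
    triple i (entries i x) = x := by
  funext k
  fin_cases i <;> fin_cases k <;> first | rfl | exact h.symm

/-- The points `[1,u,v]`, `[u,1,v]`, `[u,v,1]` of `𝕆P²` for `i = 0, 1, 2`. -/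
def point (i : Fin 3) (w : Model) : OP2 :=
  Quotient.mk ReducedTriple.setoid ⟨triple i w, i, triple_self i w⟩

theorem point_eq_iff (i j : Fin 3) (w z : Model) :
    point i w = point j z ↔ ∃ l : Octonion, l ≠ 0 ∧ ∀ k, triple i w k = triple j z k * l :=
  Quotient.eq (r := ReducedTriple.setoid)

theorem exists_point (p : OP2) : ∃ i w, point i w = p := by
  induction p using Quotient.inductionOn with
  | h x =>
    obtain ⟨x, i, hi⟩ := x
    refine ⟨i, entries i x, ?_⟩
    unfold point
    congr 2
    exact triple_entries i x hi

theorem point_injective (i : Fin 3) : Function.Injective (point i) := fun w z h => by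
  obtain ⟨l, -, hl⟩ := (point_eq_iff i i w z).1 h
  have h1 : l = 1 := by simpa [triple_self] using (hl i).symm
  rw [← entries_triple i w, ← entries_triple i z]
  congr 1
  funext k
  rw [hl k, h1, mul_one]

/-- The subset `Uᵢ/∼` of `𝕆P²`. -/
def affine (i : Fin 3) : Set OP2 := Set.range (point i)

/-- The change of coordinates from the `i`-th to the `j`-th chart. -/
def transition (i j : Fin 3) (w : Model) : Model :=
  entries j (fun k => triple i w k * (triple i w j)⁻¹)

theorem point_transition (i j : Fin 3) (w : Model) (h : triple i w j ≠ 0) :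
    point j (transition i j w) = point i w := by
  refine (point_eq_iff j i _ _).2 ⟨(triple i w j)⁻¹, inv_ne_zero' h, fun k => ?_⟩
  rw [transition, triple_entries j _ (mul_inv_self h)]

theorem point_mem_affine_iff (i j : Fin 3) (w : Model) :
    point i w ∈ affine j ↔ triple i w j ≠ 0 := by
  constructor
  · rintro ⟨z, hz⟩ h0
    obtain ⟨l, -, hl⟩ := (point_eq_iff j i z w).1 hz
    have := hl j
    rw [h0, zero_mul, triple_self] at this
    exact one_ne_zero' this
  · exact fun h => ⟨_, point_transition i j w h⟩

/-- The chart `φᵢ : Uᵢ/∼ → 𝕆 × 𝕆` as a partial bijection; it is the inverse of `point i`, so that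
for instance `φ₁ [1,u,v] = (u,v)`. -/
def affineEquiv (i : Fin 3) : PartialEquiv OP2 Model where
  toFun := Function.invFun (point i)
  invFun := point i
  source := affine i
  target := Set.univ
  map_source' _ _ := Set.mem_univ _
  map_target' w _ := Set.mem_range_self w
  left_inv' _ hp := Function.invFun_eq hp
  right_inv' w _ := Function.leftInverse_invFun (point_injective i) w

theorem affineEquiv_point (i : Fin 3) (w : Model) : affineEquiv i (point i w) = w :=
  Function.leftInverse_invFun (point_injective i) w

theorem affineEquiv_point_eq (i j : Fin 3) (w : Model) (h : triple i w j ≠ 0) :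
    affineEquiv j (point i w) = transition i j w := by
  rw [← point_transition i j w h, affineEquiv_point]

theorem contDiff_triple (i k : Fin 3) : ContDiff ℝ ω (fun w : Model => triple i w k) := by
  fin_cases i <;> fin_cases k <;>
    first | exact contDiff_const | exact contDiff_fst | exact contDiff_snd

instance : FiniteDimensional ℝ Octonion :=
  inferInstanceAs (FiniteDimensional ℝ (WithLp 2 (ℍ[ℝ] × ℍ[ℝ])))

theorem contDiff_mul : ContDiff ℝ ω (fun p : Octonion × Octonion => p.1 * p.2) := by
  let B : Octonion →ₗ[ℝ] Octonion →ₗ[ℝ] Octonion :=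
    LinearMap.mk₂ ℝ (· * ·) (fun a b c => add_mul a b c) (fun r a b => Octonion.smul_mul r a b)
      (fun a b c => mul_add a b c) (fun r a b => Octonion.mul_smul r a b)
  let C : Octonion →ₗ[ℝ] Octonion →L[ℝ] Octonion :=
    (LinearMap.toContinuousLinearMap : (Octonion →ₗ[ℝ] Octonion) ≃ₗ[ℝ] _).toLinearMap ∘ₗ B
  exact (LinearMap.toContinuousLinearMap C).isBoundedBilinearMap.contDiff

theorem contDiffOn_inv : ContDiffOn ℝ ω (fun a : Octonion => a⁻¹) {0}ᶜ := by
  let S : Octonion →ₗ[ℝ] Octonion :=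
    { toFun := star
      map_add' := fun a b => by ext1 <;> simp [add_comm]
      map_smul' := fun r a => by ext1 <;> simp }
  have hS : ContDiff ℝ ω (fun a : Octonion => star a) :=
    (LinearMap.toContinuousLinearMap S).contDiff
  have hN : ContDiff ℝ ω (fun a : Octonion => ‖a‖ ^ 2) := contDiff_norm_sq ℝ
  have hI : ContDiffOn ℝ ω (fun a : Octonion => (‖a‖ ^ 2)⁻¹) {0}ᶜ :=
    hN.contDiffOn.inv fun a ha => norm_sq_ne ha
  exact (hI.smul hS.contDiffOn).congr fun a _ => inv_def a

theorem contDiffOn_triple_inv (i j : Fin 3) :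
    ContDiffOn ℝ ω (fun w => (triple i w j)⁻¹) {w | triple i w j ≠ 0} := by
  have := ContDiffOn.comp (g := fun a : Octonion => a⁻¹) contDiffOn_inv
    (contDiff_triple i j).contDiffOn (s := {w | triple i w j ≠ 0})
    (fun w hw => Set.mem_compl_singleton_iff.2 hw)
  exact this

theorem contDiffOn_triple_div (i j k : Fin 3) :
    ContDiffOn ℝ ω (fun w => triple i w k * (triple i w j)⁻¹) {w | triple i w j ≠ 0} := by
  have h2 : ContDiffOn ℝ ω (fun w => triple i w k) {w | triple i w j ≠ 0} :=
    (contDiff_triple i k).contDiffOn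
  have h3 := h2.prodMk (contDiffOn_triple_inv i j)
  have := ContDiff.comp_contDiffOn (g := fun p : Octonion × Octonion => p.1 * p.2) contDiff_mul h3
  exact this

theorem contDiffOn_transition (i j : Fin 3) :
    ContDiffOn ℝ ω (transition i j) {w | triple i w j ≠ 0} := by
  have h := contDiffOn_triple_div i j
  unfold transition entries
  fin_cases j
  · exact (h 1).prodMk (h 2)
  · exact (h 0).prodMk (h 2)
  · exact (h 0).prodMk (h 1)

theorem trans_source (i j : Fin 3) :
    ((affineEquiv i).symm.trans (affineEquiv j)).source = {w | triple i w j ≠ 0} := by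
  ext w
  rw [PartialEquiv.trans_source, Set.mem_ofPred_eq, ← point_mem_affine_iff]
  exact ⟨fun h => h.2, fun h => ⟨Set.mem_univ _, h⟩⟩

theorem trans_eqOn (i j : Fin 3) : Set.EqOn ((affineEquiv i).symm.trans (affineEquiv j))
    (transition i j) {w | triple i w j ≠ 0} :=
  fun w hw => affineEquiv_point_eq i j w hw

theorem exists_mem_affine (p : OP2) : ∃ i, p ∈ affine i := by
  obtain ⟨i, w, h⟩ := exists_point p
  exact ⟨i, w, h⟩

/-- The atlas `(Uᵢ/∼, φᵢ)`, `i = 1, 2, 3`. -/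
def atlasCore : ChartedSpaceCore Model OP2 where
  atlas := Set.range affineEquiv
  chartAt p := affineEquiv (exists_mem_affine p).choose
  mem_chart_source p := (exists_mem_affine p).choose_spec
  chart_mem_atlas p := Set.mem_range_self _
  open_source := by
    rintro _ _ ⟨i, rfl⟩ ⟨j, rfl⟩
    rw [trans_source]
    exact isOpen_ne_fun (contDiff_triple i j).continuous continuous_const
  continuousOn_toFun := by
    rintro _ _ ⟨i, rfl⟩ ⟨j, rfl⟩
    rw [trans_source]
    exact (contDiffOn_transition i j).continuousOn.congr (trans_eqOn i j)

/-- The topology of `𝕆P²`, determined by the atlas. -/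
instance : TopologicalSpace OP2 := atlasCore.toTopologicalSpace

instance : ChartedSpace Model OP2 := atlasCore.toChartedSpace

theorem mem_atlas_iff {e : OpenPartialHomeomorph OP2 Model} : e ∈ atlas Model OP2 ↔
    ∃ (e' : PartialEquiv OP2 Model) (h : e' ∈ Set.range affineEquiv),
      e = atlasCore.openPartialHomeomorph e' h := by
  show e ∈ (⋃ (e' : PartialEquiv OP2 Model) (he : e' ∈ atlasCore.atlas),
    {atlasCore.openPartialHomeomorph e' he}) ↔ _
  simp only [Set.mem_iUnion, Set.mem_singleton_iff]
  rfl

/-- `𝕆P²` is a real analytic manifold. -/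
instance : IsManifold 𝓘(ℝ, Model) ω OP2 := by
  apply isManifold_of_contDiffOn
  intro e e' he he'
  obtain ⟨_, ⟨i, rfl⟩, rfl⟩ := mem_atlas_iff.1 he
  obtain ⟨_, ⟨j, rfl⟩, rfl⟩ := mem_atlas_iff.1 he'
  have h := (contDiffOn_transition i j).congr (trans_eqOn i j)
  rw [← trans_source] at h
  simp only [modelWithCornersSelf_coe, modelWithCornersSelf_coe_symm, Set.range_id, Set.inter_univ,
    Set.preimage_id, Function.comp_id, Function.id_comp]
  exact h

/-- The line element
`ds² = (|du|²(1+|v|²) + |dv|²(1+|u|²) - 2 Re[(u v̄)(dv dū)]) / (1+|u|²+|v|²)²`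
at the point with coordinates `w = (u,v)`, on the vector `d = (du,dv)`. -/
def lineElement (w d : Model) : ℝ :=
  (‖d.1‖ ^ 2 * (1 + ‖w.2‖ ^ 2) + ‖d.2‖ ^ 2 * (1 + ‖w.1‖ ^ 2)
      - 2 * ((w.1 * star w.2) * (d.2 * star d.1)).re) /
    (1 + ‖w.1‖ ^ 2 + ‖w.2‖ ^ 2) ^ 2

/-- `ds²(ξ)` for a tangent vector `ξ` at `p`, computed in the coordinates of the chart `φᵢ`
(meaningful for `p ∈ Uᵢ/∼`). -/
def dsSq (i : Fin 3) (p : OP2) (ξ : TangentSpace 𝓘(ℝ, Model) p) : ℝ :=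
  lineElement (affineEquiv i p) (mfderiv 𝓘(ℝ, Model) 𝓘(ℝ, Model) (affineEquiv i) p ξ)

/-- `f` restricts to an (analytic) isometry from the open set `U` onto the open set `V`: it is an
analytic bijection `U → V` with analytic inverse, and it preserves `ds²`, whichever of the charts
are used to compute it at the source and at the target. -/
structure IsIsometryOn (f : OP2 → OP2) (U V : Set OP2) : Prop where
  isOpen_source : IsOpen U
  isOpen_target : IsOpen V
  bijOn : Set.BijOn f U V
  contMDiffOn : ContMDiffOn 𝓘(ℝ, Model) 𝓘(ℝ, Model) ω f U
  contMDiffOn_inverse : ∃ g : OP2 → OP2, Set.InvOn g f U V ∧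
    ContMDiffOn 𝓘(ℝ, Model) 𝓘(ℝ, Model) ω g V
  dsSq_map : ∀ p ∈ U, ∀ i j : Fin 3, p ∈ affine i → f p ∈ affine j →
    ∀ ξ : TangentSpace 𝓘(ℝ, Model) p,
      dsSq j (f p) (mfderiv 𝓘(ℝ, Model) 𝓘(ℝ, Model) f p ξ) = dsSq i p ξ

/-- The map `[1,u,v] ↦ [1, ru + λv, λ̄u - rv]`. Only its restriction to `U₁/∼ = affine 0` is
meaningful. -/
def reflection (r : ℝ) (l : Octonion) (p : OP2) : OP2 :=
  point 0 (r • (affineEquiv 0 p).1 + l * (affineEquiv 0 p).2,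
    star l * (affineEquiv 0 p).1 - r • (affineEquiv 0 p).2)

theorem reflection_point (r : ℝ) (l u v : Octonion) :
    reflection r l (point 0 (u, v)) = point 0 (r • u + l * v, star l * u - r • v) := by
  rw [reflection, affineEquiv_point]

end OP2

end

/-!
Send the line spanned by `x` to its projection matrix `x x* / |x|²`. This Veronese map is an
analytic embedding of `𝕆P²` into the Hermitian octonionic `3 × 3` matrices, and `ds²` is half of the
Hilbert-Schmidt form pulled back along it. Through this embedding the reflection on `U₁/∼` becomes
the restriction of a linear isometry of the matrix space, `X ↦ A X A` with `A` Hermitian and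
`A² = 1`. As `𝕆P²` is compact, its image is closed; the linear isometry maps the image of the dense
set `U₁/∼` into it, hence the whole image, and this extends the reflection to an analytic isometry
of `𝕆P²`. Uniqueness and involutivity are again consequences of the density of `U₁/∼`.
-/

noncomputable section

namespace Octonion

instance : StarRing Octonion where
  star_involutive := star_star'
  star_mul a b := by ext <;> simp
  star_add a b := by ext1 <;> simp [add_comm]

instance : StarModule ℝ Octonion := ⟨fun r a => by ext1 <;> simp⟩

instance : IsScalarTower ℝ Octonion Octonion := ⟨smul_mul⟩

instance : SMulCommClass ℝ Octonion Octonion := ⟨fun r a b => (mul_smul r a b).symm⟩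

instance : Nontrivial Octonion := ⟨1, 0, one_ne_zero'⟩

instance : NormedStarGroup Octonion :=
  ⟨fun a => (pow_le_pow_iff_left₀ (norm_nonneg _) (norm_nonneg _) two_ne_zero).1 (norm_star' a).le⟩

theorem mul_star_mul (a b : Octonion) : a * (star a * b) = (‖a‖ ^ 2) • b := by
  simpa using star_mul_mul (star a) b

theorem inner_star_star (a b : Octonion) : inner ℝ (star a) (star b) = inner ℝ a b := by
  simp only [inner_eq_re, re, left_mul, left_star, right_star, Quaternion.re_sub, Quaternion.re_mul,
    Quaternion.re_star, Quaternion.imI_star, Quaternion.imJ_star, Quaternion.imK_star,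
    star_neg, Quaternion.re_neg, Quaternion.imI_neg, Quaternion.imJ_neg, Quaternion.imK_neg]
  ring

theorem inner_mul_left_eq (a b c : Octonion) : inner ℝ (a * b) c = inner ℝ b (star a * c) := by
  simp only [inner_eq_re, re, left_mul, right_mul, left_star, right_star, star_neg, star_sub,
    Quaternion.re_add, Quaternion.re_sub, Quaternion.re_neg, Quaternion.re_mul,
    Quaternion.re_star, Quaternion.imI_add, Quaternion.imI_sub, Quaternion.imI_neg,
    Quaternion.imI_mul, Quaternion.imI_star, Quaternion.imJ_add, Quaternion.imJ_sub,
    Quaternion.imJ_neg, Quaternion.imJ_mul, Quaternion.imJ_star, Quaternion.imK_add,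
    Quaternion.imK_sub, Quaternion.imK_neg, Quaternion.imK_mul, Quaternion.imK_star]
  ring

theorem inner_mul_right_eq (a b c : Octonion) : inner ℝ (a * b) c = inner ℝ a (c * star b) := by
  rw [← inner_star_star, star_mul, inner_mul_left_eq, ← inner_star_star, star_mul]
  simp only [star_star]

theorem inner_mul_mul_right (a b c : Octonion) :
    inner ℝ (a * c) (b * c) = ‖c‖ ^ 2 * inner ℝ a b := by
  rw [inner_mul_right_eq, mul_mul_star, inner_smul_right]

theorem inner_mul_mul_left (a b c : Octonion) :
    inner ℝ (c * a) (c * b) = ‖c‖ ^ 2 * inner ℝ a b := by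
  rw [inner_mul_left_eq, star_mul_mul, inner_smul_right]

instance : NormMulClass Octonion where
  norm_mul a b := by
    rw [← sq_eq_sq₀ (norm_nonneg _) (by positivity), mul_pow, ← real_inner_self_eq_norm_sq,
      inner_mul_mul_left, real_inner_self_eq_norm_sq]

instance : NormOneClass Octonion where
  norm_one := (mul_eq_left₀ (norm_ne_zero_iff.2 one_ne_zero)).1 <| by
    rw [← norm_mul, mul_one]

theorem inner_mul_mul_add_inner_mul_mul (a b c d : Octonion) :
    inner ℝ (a * c) (b * d) + inner ℝ (a * d) (b * c) = 2 * inner ℝ a b * inner ℝ c d := by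
  have h := inner_mul_mul_right a b (c + d)
  rw [mul_add, mul_add, inner_add_left, inner_add_right, inner_add_right, inner_mul_mul_right,
    inner_mul_mul_right, norm_add_sq_real] at h
  linear_combination h

theorem re_mul_eq_inner (a b : Octonion) : (a * b).re = inner ℝ a (star b) := by
  rw [inner_eq_re, star_star]

/-- The middle Moufang identity `(l v) (ū l) = l (v ū) l`, with the right-hand side evaluated. -/
theorem mul_mul_star_mul_self (l v u : Octonion) :
    (l * v) * (star u * l) = (2 * inner ℝ l (u * star v)) • l - (‖l‖ ^ 2) • (u * star v) := by
  refine ext_inner_right ℝ fun z => ?_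
  have h := inner_mul_mul_add_inner_mul_mul l z v (star l * u)
  rw [mul_star_mul, inner_smul_left, real_inner_comm (z * v), inner_mul_right_eq z v u,
    real_inner_comm (u * star v), ← inner_mul_left_eq l v u, inner_mul_right_eq l v u] at h
  rw [inner_mul_right_eq, star_mul, star_star, inner_sub_left, inner_smul_left, inner_smul_left]
  simp only [conj_trivial] at h ⊢
  linear_combination h

theorem contDiff_star {n : WithTop ℕ∞} : ContDiff ℝ n (star : Octonion → Octonion) :=
  (starL' ℝ : Octonion ≃L[ℝ] Octonion).contDiff

theorem norm_sq_smul_eq_star {a b : Octonion} (h : a * b = 1) : (‖b‖ ^ 2) • a = star b := by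
  rw [← mul_mul_star, h, one_mul]

theorem mul_mul_star_mul {a b l : Octonion}
    (h : l = 1 ∨ a = 1 ∨ b = 1 ∨ a * l = 1 ∨ b * l = 1) :
    (a * l) * star (b * l) = (‖l‖ ^ 2) • (a * star b) := by
  rcases h with rfl | rfl | rfl | h | h
  · simp
  · rw [one_mul, one_mul, star_mul, mul_star_mul]
  · rw [one_mul, mul_mul_star, star_one, mul_one]
  · rw [h, one_mul, ← smul_mul_assoc, norm_sq_smul_eq_star h, star_mul]
  · rw [h, star_one, mul_one, ← mul_smul_comm, ← star_trivial (‖l‖ ^ 2), ← star_smul,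
      norm_sq_smul_eq_star h, star_star]

theorem norm_sq_smul_add_mul (r : ℝ) (l u v : Octonion) : ‖r • u + l * v‖ ^ 2 =
    r ^ 2 * ‖u‖ ^ 2 + ‖l‖ ^ 2 * ‖v‖ ^ 2 + 2 * r * inner ℝ l (u * star v) := by
  rw [norm_add_sq_real, norm_smul, norm_mul, real_inner_smul_left, real_inner_comm,
    inner_mul_right_eq, mul_pow, Real.norm_eq_abs, sq_abs]
  ring

theorem norm_sq_star_mul_sub_smul (r : ℝ) (l u v : Octonion) : ‖star l * u - r • v‖ ^ 2 =
    ‖l‖ ^ 2 * ‖u‖ ^ 2 + r ^ 2 * ‖v‖ ^ 2 - 2 * r * inner ℝ l (u * star v) := by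
  rw [norm_sub_sq_real, norm_smul, norm_mul, norm_star, real_inner_smul_right, real_inner_comm,
    ← inner_mul_left_eq, inner_mul_right_eq, mul_pow, mul_pow, Real.norm_eq_abs, sq_abs]
  ring

section

variable {r : ℝ} {l : Octonion} (h : r ^ 2 + ‖l‖ ^ 2 = 1)
include h

theorem norm_sq_smul_add_mul_add_norm_sq_star_mul_sub_smul (u v : Octonion) :
    ‖r • u + l * v‖ ^ 2 + ‖star l * u - r • v‖ ^ 2 = ‖u‖ ^ 2 + ‖v‖ ^ 2 := by
  rw [norm_sq_smul_add_mul, norm_sq_star_mul_sub_smul]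
  linear_combination (‖u‖ ^ 2 + ‖v‖ ^ 2) * h

theorem smul_add_mul_mul_star_star_mul_sub_smul (u v : Octonion) :
    (r • u + l * v) * star (star l * u - r • v) =
      (r * (‖u‖ ^ 2 - ‖v‖ ^ 2) + 2 * inner ℝ l (u * star v)) • l - u * star v := by
  rw [star_sub, star_mul, star_star, star_smul, star_trivial r, mul_sub, add_mul, add_mul,
    smul_mul_assoc, smul_mul_assoc, mul_smul_comm, mul_smul_comm, mul_mul_star_mul_self,
    mul_star_mul, mul_mul_star]
  linear_combination (norm := module) -(h • (u * star v))

end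

end Octonion

namespace OP2

open Octonion

/-- Hermitian octonionic `3 × 3` matrices, encoded by the diagonal and by the entries in the
positions `(0,1), (1,2), (2,0)`. -/
abbrev Herm : Type := (Fin 3 → ℝ) × (Fin 3 → Octonion)

/-- The `j`-th column of a Hermitian matrix. -/
def column (j : Fin 3) : Herm →ₗ[ℝ] Fin 3 → Octonion where
  toFun X k := if k = j then X.1 j • 1 else if k = j + 1 then star (X.2 j) else X.2 k
  map_add' X Y := by
    funext k
    simp only [Prod.fst_add, Prod.snd_add, Pi.add_apply, add_smul, star_add]
    split_ifs <;> rfl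
  map_smul' c X := by
    funext k
    simp only [Prod.smul_fst, Prod.smul_snd, Pi.smul_apply, star_smul, star_trivial, smul_eq_mul,
      ← smul_smul, RingHom.id_apply, smul_ite]

/-- The matrix `x x*`. -/
def outer (x : Fin 3 → Octonion) : Herm :=
  (fun k => ‖x k‖ ^ 2, fun k => x k * star (x (k + 1)))

/-- The squared norm of a triple. -/
def normSq (x : Fin 3 → Octonion) : ℝ := ∑ k, ‖x k‖ ^ 2

theorem normSq_pos {x : Fin 3 → Octonion} {i : Fin 3} (h : x i = 1) : 0 < normSq x :=
  Finset.sum_pos' (fun k _ => sq_nonneg _) ⟨i, Finset.mem_univ i, by simp [h]⟩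

/-- `x x* / |x|²`, the matrix of the orthogonal projection onto the line spanned by `x`. -/
def projMatrix (x : Fin 3 → Octonion) : Herm := (normSq x)⁻¹ • outer x

theorem outer_eq_smul_of_rel {x y : Fin 3 → Octonion} {i j : Fin 3} {l : Octonion}
    (hx : x i = 1) (hy : y j = 1) (h : ∀ k, x k = y k * l) :
    outer x = ‖l‖ ^ 2 • outer y := by
  have hl : i = j → l = 1 := fun hij => by rw [← hx, h, hij, hy, one_mul]
  refine Prod.ext (funext fun k => ?_) (funext fun k => ?_)
  · simp only [outer, h, norm_mul, mul_pow, Prod.smul_fst, Pi.smul_apply, smul_eq_mul, mul_comm]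
  · have key : i = j ∨ k = j ∨ k + 1 = j ∨ k = i ∨ k + 1 = i := by omega
    simp only [outer, Prod.smul_snd, Pi.smul_apply]
    rw [h, h, mul_mul_star_mul]
    rw [← h, ← h]
    rcases key with hij | rfl | rfl | rfl | rfl
    · exact .inl (hl hij)
    all_goals simp only [hx, hy, true_or, or_true]

theorem projMatrix_eq_of_outer_eq_smul {x y : Fin 3 → Octonion} {c : ℝ} (hc : c ≠ 0)
    (h : outer x = c • outer y) : projMatrix x = projMatrix y := by
  have hN : normSq x = c * normSq y := by
    simp only [normSq, Finset.mul_sum]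
    exact Finset.sum_congr rfl fun k _ => congrFun (congrArg Prod.fst h) k
  rw [projMatrix, projMatrix, h, hN, smul_smul, mul_inv_rev, inv_mul_cancel_right₀ hc]

/-- The Veronese embedding of `𝕆P²` into the Hermitian matrices. -/
def veronese : OP2 → Herm :=
  Quotient.lift (fun x : ReducedTriple => projMatrix x.1) fun
    | ⟨_, _, hx⟩, ⟨_, _, hy⟩, ⟨_, hl, h⟩ =>
      projMatrix_eq_of_outer_eq_smul (norm_sq_ne hl) (outer_eq_smul_of_rel hx hy h)

theorem veronese_point (i : Fin 3) (w : Model) :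
    veronese (point i w) = projMatrix (triple i w) := rfl

theorem veronese_diag_ne_zero_iff (p : OP2) (j : Fin 3) :
    (veronese p).1 j ≠ 0 ↔ p ∈ affine j := by
  obtain ⟨i, w, rfl⟩ := exists_point p
  have hN := (normSq_pos (triple_self i w)).ne'
  rw [point_mem_affine_iff, veronese_point]
  simp [projMatrix, outer, hN]

/-- The affine coordinates of the line with a given projection matrix, read off from the `j`-th
column. -/
def affineCoord (j : Fin 3) (X : Herm) : Model := entries j ((X.1 j)⁻¹ • column j X)

theorem column_outer {j : Fin 3} {x : Fin 3 → Octonion} (h : x j = 1) :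
    column j (outer x) = x := by
  funext k
  have hk : k = j ∨ k = j + 1 ∨ k + 1 = j := by omega
  rcases hk with rfl | rfl | rfl
  · simp [column, outer, h]
  · simp [column, outer, h]
  · have hk : k ≠ k + 1 + 1 := by omega
    simp [column, outer, h, hk]

theorem affineCoord_projMatrix {j : Fin 3} {x : Fin 3 → Octonion} (h : x j = 1) :
    affineCoord j (projMatrix x) = entries j x := by
  have hN := (normSq_pos h).ne'
  have hd : (projMatrix x).1 j = (normSq x)⁻¹ := by simp [projMatrix, outer, h]
  rw [affineCoord, hd, projMatrix, map_smul, column_outer h, inv_inv, smul_inv_smul₀ hN]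

theorem point_affineCoord_veronese {p : OP2} {j : Fin 3} (h : p ∈ affine j) :
    point j (affineCoord j (veronese p)) = p := by
  obtain ⟨w, rfl⟩ := h
  rw [veronese_point, affineCoord_projMatrix (triple_self j w), entries_triple]

theorem veronese_injective : Function.Injective veronese := fun p q h => by
  obtain ⟨j, hp⟩ := exists_mem_affine p
  have hq : q ∈ affine j := by rwa [← veronese_diag_ne_zero_iff, ← h, veronese_diag_ne_zero_iff]
  rw [← point_affineCoord_veronese hp, h, point_affineCoord_veronese hq]

theorem contDiff_mul_star {E : Type*} [NormedAddCommGroup E] [NormedSpace ℝ E] {n : WithTop ℕ∞}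
    {f g : E → Octonion} (hf : ContDiff ℝ n f) (hg : ContDiff ℝ n g) :
    ContDiff ℝ n fun x => f x * star (g x) := by
  have hmul : ContDiff ℝ n fun p : Octonion × Octonion => p.1 * p.2 := contDiff_mul.of_le le_top
  exact hmul.comp (f := fun x => (f x, star (g x))) (hf.prodMk (contDiff_star.comp hg))

theorem contDiff_outer {n : WithTop ℕ∞} : ContDiff ℝ n outer := by
  have hx : ∀ k, ContDiff ℝ n fun x : Fin 3 → Octonion => x k := contDiff_apply ℝ Octonion
  exact (contDiff_pi.2 fun k => (hx k).norm_sq ℝ).prodMk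
    (contDiff_pi.2 fun k => contDiff_mul_star (hx k) (hx (k + 1)))

theorem contDiffAt_projMatrix {n : WithTop ℕ∞} {x : Fin 3 → Octonion} (hx : normSq x ≠ 0) :
    ContDiffAt ℝ n projMatrix x := by
  have hN : ContDiff ℝ n normSq := ContDiff.sum fun k _ => (contDiff_apply ℝ Octonion k).norm_sq ℝ
  exact (hN.contDiffAt.inv hx).smul contDiff_outer.contDiffAt

theorem contDiff_projMatrix_triple (i : Fin 3) :
    ContDiff ℝ ω fun w : Model => projMatrix (triple i w) :=
  contDiff_iff_contDiffAt.2 fun w => (contDiffAt_projMatrix (normSq_pos (triple_self i w)).ne').comp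
    w (contDiff_pi.2 (contDiff_triple i)).contDiffAt

theorem contDiffAt_affineCoord {n : WithTop ℕ∞} {j : Fin 3} {X : Herm} (h : X.1 j ≠ 0) :
    ContDiffAt ℝ n (affineCoord j) X := by
  have hd : ContDiffAt ℝ n (fun X : Herm => (X.1 j)⁻¹) X :=
    ContDiffAt.inv ((contDiff_apply ℝ ℝ j).comp contDiff_fst).contDiffAt h
  have hc := contDiffAt_pi.1 <|
    hd.smul (LinearMap.toContinuousLinearMap (column j)).contDiff.contDiffAt
  unfold affineCoord entries
  fin_cases j
  · exact (hc 1).prodMk (hc 2)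
  · exact (hc 0).prodMk (hc 2)
  · exact (hc 0).prodMk (hc 1)

/-- The Hilbert-Schmidt inner product of two Hermitian matrices. -/
def hsInner (X Y : Herm) : ℝ := ∑ k, (X.1 k * Y.1 k + 2 * inner ℝ (X.2 k) (Y.2 k))

/-- The squared Hilbert-Schmidt norm of a Hermitian matrix. -/
def hsNormSq (X : Herm) : ℝ := ∑ k, (X.1 k ^ 2 + 2 * ‖X.2 k‖ ^ 2)

theorem hsNormSq_smul_sub_smul (a b : ℝ) (X Y : Herm) :
    hsNormSq (a • X - b • Y) =
      a ^ 2 * hsNormSq X - 2 * a * b * hsInner X Y + b ^ 2 * hsNormSq Y := by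
  simp only [hsNormSq, hsInner, Finset.mul_sum, ← Finset.sum_sub_distrib, ← Finset.sum_add_distrib,
    Prod.fst_sub, Prod.snd_sub, Prod.smul_fst, Prod.smul_snd, Pi.sub_apply, Pi.smul_apply,
    smul_eq_mul, norm_sub_sq_real, norm_smul, mul_pow, Real.norm_eq_abs, sq_abs,
    real_inner_smul_left, real_inner_smul_right]
  exact Finset.sum_congr rfl fun k _ => by ring

/-- The derivative of `outer` at `x` in the direction `ξ`, the matrix `x ξ* + ξ x*`. -/
def outerDeriv (x ξ : Fin 3 → Octonion) : Herm :=
  (fun k => 2 * inner ℝ (x k) (ξ k), fun k => x k * star (ξ (k + 1)) + ξ k * star (x (k + 1)))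

theorem outer_add_smul (x ξ : Fin 3 → Octonion) (t : ℝ) :
    outer (x + t • ξ) = outer x + t • outerDeriv x ξ + t ^ 2 • outer ξ := by
  refine Prod.ext (funext fun k => ?_) (funext fun k => ?_)
  · simp only [outer, outerDeriv, Prod.fst_add, Prod.smul_fst, Pi.add_apply, Pi.smul_apply,
      smul_eq_mul, norm_add_sq_real, norm_smul, mul_pow, real_inner_smul_right, Real.norm_eq_abs,
      sq_abs]
    ring
  · simp only [outer, outerDeriv, Prod.snd_add, Prod.smul_snd, Pi.add_apply, Pi.smul_apply,
      star_add, star_smul, star_trivial, mul_add, add_mul, smul_mul_assoc, mul_smul_comm]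
    module

theorem hasLineDerivAt_outer (x ξ : Fin 3 → Octonion) :
    HasLineDerivAt ℝ outer (outerDeriv x ξ) x ξ := by
  have h := ((hasDerivAt_const (0 : ℝ) (outer x)).add
    ((hasDerivAt_id (0 : ℝ)).smul_const (outerDeriv x ξ))).add
      (((hasDerivAt_id (0 : ℝ)).pow 2).smul_const (outer ξ))
  simpa [HasLineDerivAt, outer_add_smul] using! h

theorem hasLineDerivAt_normSq (x ξ : Fin 3 → Octonion) :
    HasLineDerivAt ℝ normSq (2 * ∑ k, inner ℝ (x k) (ξ k)) x ξ := by
  rw [Finset.mul_sum]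
  exact HasDerivAt.fun_sum fun k _ => hasDerivAt_pi.1 (hasLineDerivAt_outer x ξ).fst k

/-- The derivative of `projMatrix` at `x` in the direction `ξ`. -/
def projMatrixDeriv (x ξ : Fin 3 → Octonion) : Herm :=
  (normSq x)⁻¹ • outerDeriv x ξ - (2 * (∑ k, inner ℝ (x k) (ξ k)) / normSq x ^ 2) • outer x

theorem hasLineDerivAt_projMatrix {x : Fin 3 → Octonion} (ξ : Fin 3 → Octonion)
    (hx : normSq x ≠ 0) : HasLineDerivAt ℝ projMatrix (projMatrixDeriv x ξ) x ξ := by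
  have hx₀ : x + (0 : ℝ) • ξ = x := by simp
  have h := ((hasLineDerivAt_normSq x ξ).fun_inv (by rwa [hx₀])).fun_smul
    (hasLineDerivAt_outer x ξ)
  rw [hx₀] at h
  refine h.congr_deriv ?_
  rw [projMatrixDeriv, neg_div, neg_smul, sub_eq_add_neg]

theorem hsNormSq_outer (x : Fin 3 → Octonion) : hsNormSq (outer x) = normSq x ^ 2 := by
  simp only [hsNormSq, outer, normSq, norm_mul, norm_star, Fin.sum_univ_three, Fin.reduceAdd]
  ring

theorem hsInner_outerDeriv_outer (x ξ : Fin 3 → Octonion) :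
    hsInner (outerDeriv x ξ) (outer x) = 2 * normSq x * ∑ k, inner ℝ (x k) (ξ k) := by
  simp only [hsInner, outer, outerDeriv, normSq, inner_add_left, inner_mul_mul_left,
    inner_mul_mul_right, inner_star_star, norm_star, Fin.sum_univ_three, Fin.reduceAdd]
  simp only [real_inner_comm (x _)]
  ring

/-- The line element of `𝕆P²` in homogeneous form: `ds²` at the line spanned by `x`, on the velocity
`ξ` of a curve of triples through `x`. The paper's `ds²` is the case where one entry of `x` is `1`
and the corresponding entry of `ξ` is `0`. -/
def homogLineElement (x ξ : Fin 3 → Octonion) : ℝ :=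
  (∑ k, (‖x k‖ ^ 2 * ‖ξ (k + 1)‖ ^ 2 + ‖ξ k‖ ^ 2 * ‖x (k + 1)‖ ^ 2
    - 2 * inner ℝ (x k * star (x (k + 1))) (ξ k * star (ξ (k + 1))))) / normSq x ^ 2

theorem norm_sq_mul_star_add_mul_star (x y ξ η : Octonion) :
    ‖x * star η + ξ * star y‖ ^ 2 = ‖x‖ ^ 2 * ‖η‖ ^ 2 + ‖ξ‖ ^ 2 * ‖y‖ ^ 2 +
      4 * inner ℝ x ξ * inner ℝ y η - 2 * inner ℝ (x * star y) (ξ * star η) := by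
  have h := inner_mul_mul_add_inner_mul_mul x ξ (star y) (star η)
  rw [inner_star_star] at h
  rw [norm_add_sq_real, norm_mul, norm_mul, norm_star, norm_star]
  linear_combination 2 * h

theorem hsNormSq_outerDeriv {x : Fin 3 → Octonion} (ξ : Fin 3 → Octonion) (hx : normSq x ≠ 0) :
    hsNormSq (outerDeriv x ξ) =
      4 * (∑ k, inner ℝ (x k) (ξ k)) ^ 2 + 2 * (normSq x ^ 2 * homogLineElement x ξ) := by
  rw [homogLineElement, mul_div_cancel₀ _ (pow_ne_zero 2 hx)]
  simp only [hsNormSq, outerDeriv, norm_sq_mul_star_add_mul_star, Fin.sum_univ_three, Fin.reduceAdd]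
  ring

theorem hsNormSq_projMatrixDeriv {x : Fin 3 → Octonion} (ξ : Fin 3 → Octonion)
    (hx : normSq x ≠ 0) : hsNormSq (projMatrixDeriv x ξ) = 2 * homogLineElement x ξ := by
  rw [projMatrixDeriv, hsNormSq_smul_sub_smul, hsNormSq_outerDeriv ξ hx, hsInner_outerDeriv_outer,
    hsNormSq_outer]
  field_simp
  ring

/-- The derivative of `triple i`: the vector `(0, a, b)`, `(a, 0, b)` or `(a, b, 0)`. -/
def tangentTriple (i : Fin 3) (d : Model) : Fin 3 → Octonion :=
  match i with
  | 0 => ![0, d.1, d.2]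
  | 1 => ![d.1, 0, d.2]
  | 2 => ![d.1, d.2, 0]

theorem triple_add_smul (i : Fin 3) (w d : Model) (t : ℝ) :
    triple i (w + t • d) = triple i w + t • tangentTriple i d := by
  funext k
  fin_cases i <;> fin_cases k <;> simp [triple, tangentTriple]

theorem normSq_triple (i : Fin 3) (w : Model) :
    normSq (triple i w) = 1 + ‖w.1‖ ^ 2 + ‖w.2‖ ^ 2 := by
  fin_cases i <;> simp [normSq, Fin.sum_univ_three, triple] <;> ring

theorem homogLineElement_triple (i : Fin 3) (w d : Model) :
    homogLineElement (triple i w) (tangentTriple i d) = lineElement w d := by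
  have hre : ((w.1 * star w.2) * (d.2 * star d.1)).re =
      inner ℝ (w.1 * star w.2) (d.1 * star d.2) := by
    rw [re_mul_eq_inner, star_mul, star_star]
  have hswap : inner ℝ (w.2 * star w.1) (d.2 * star d.1) =
      inner ℝ (w.1 * star w.2) (d.1 * star d.2) := by
    rw [← inner_star_star, star_mul, star_mul, star_star, star_star]
  unfold homogLineElement lineElement
  rw [hre]
  congr 1
  · fin_cases i <;>
    · simp only [triple, tangentTriple, Fin.sum_univ_three, Fin.isValue, Fin.reduceAdd,
        Matrix.cons_val, norm_zero, norm_one, star_zero, star_one, mul_zero, zero_mul, mul_one,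
        inner_zero_right, hswap]
      ring
  · rw [normSq_triple]

theorem hsNormSq_fderiv_projMatrix_triple (i : Fin 3) (w d : Model) :
    hsNormSq (fderiv ℝ (fun w : Model => projMatrix (triple i w)) w d) = 2 * lineElement w d := by
  have hN := (normSq_pos (triple_self i w)).ne'
  have hline : HasLineDerivAt ℝ (fun w : Model => projMatrix (triple i w))
      (projMatrixDeriv (triple i w) (tangentTriple i d)) w d := by
    simpa only [HasLineDerivAt, triple_add_smul] using hasLineDerivAt_projMatrix _ hN
  rw [← ((contDiff_projMatrix_triple i).differentiable (by simp) w).lineDeriv_eq_fderiv,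
    hline.lineDeriv, hsNormSq_projMatrixDeriv _ hN, homogLineElement_triple]

/-- The `i`-th affine chart as an open partial homeomorphism. -/
def affineChart (i : Fin 3) : OpenPartialHomeomorph OP2 Model :=
  atlasCore.openPartialHomeomorph (affineEquiv i) (Set.mem_range_self i)

theorem affineChart_mem_maximalAtlas (i : Fin 3) :
    affineChart i ∈ IsManifold.maximalAtlas 𝓘(ℝ, Model) ω OP2 :=
  IsManifold.subset_maximalAtlas (mem_atlas_iff.2 ⟨_, Set.mem_range_self i, rfl⟩)

theorem isOpen_affine (i : Fin 3) : IsOpen (affine i) := (affineChart i).open_source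

theorem contMDiffAt_affineEquiv {i : Fin 3} {p : OP2} (h : p ∈ affine i) :
    ContMDiffAt 𝓘(ℝ, Model) 𝓘(ℝ, Model) ω (affineEquiv i) p :=
  contMDiffAt_of_mem_maximalAtlas (affineChart_mem_maximalAtlas i) h

theorem contMDiff_point (i : Fin 3) : ContMDiff 𝓘(ℝ, Model) 𝓘(ℝ, Model) ω (point i) := fun w =>
  contMDiffAt_symm_of_mem_maximalAtlas (affineChart_mem_maximalAtlas i) (Set.mem_univ w)

theorem veronese_eventuallyEq {i : Fin 3} {p : OP2} (h : p ∈ affine i) :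
    veronese =ᶠ[nhds p] (fun w : Model => projMatrix (triple i w)) ∘ affineEquiv i := by
  filter_upwards [(isOpen_affine i).mem_nhds h] with q hq
  obtain ⟨w, rfl⟩ := hq
  rw [Function.comp_apply, affineEquiv_point, veronese_point]

theorem contMDiff_veronese : ContMDiff 𝓘(ℝ, Model) 𝓘(ℝ, Herm) ω veronese := fun p => by
  obtain ⟨i, hi⟩ := exists_mem_affine p
  refine ContMDiffAt.congr_of_eventuallyEq ?_ (veronese_eventuallyEq hi)
  exact (contDiff_projMatrix_triple i).contMDiff.contMDiffAt.comp p (contMDiffAt_affineEquiv hi)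

theorem contMDiff_of_veronese_comp {E H M : Type*} [NormedAddCommGroup E] [NormedSpace ℝ E]
    [TopologicalSpace H] {I : ModelWithCorners ℝ E H} [TopologicalSpace M] [ChartedSpace H M]
    {n : WithTop ℕ∞} {f : M → OP2} (hf : ContMDiff I 𝓘(ℝ, Herm) n (veronese ∘ f)) :
    ContMDiff I 𝓘(ℝ, Model) n f := fun x => by
  obtain ⟨j, hj⟩ := exists_mem_affine (f x)
  have hdiag : Continuous fun y => (veronese (f y)).1 j :=
    (continuous_apply j).comp (continuous_fst.comp hf.continuous)
  have hj' := (veronese_diag_ne_zero_iff _ j).2 hj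
  have hlocal : f =ᶠ[nhds x] point j ∘ affineCoord j ∘ veronese ∘ f := by
    filter_upwards [hdiag.continuousAt.eventually_ne hj'] with y hy
    exact (point_affineCoord_veronese ((veronese_diag_ne_zero_iff _ j).1 hy)).symm
  refine ContMDiffAt.congr_of_eventuallyEq ?_ hlocal
  exact ((contMDiff_point j).of_le le_top).contMDiffAt.comp x
    ((contDiffAt_affineCoord hj').contMDiffAt.comp x hf.contMDiffAt)

instance : T2Space OP2 := T2Space.of_injective_continuous veronese_injective
  contMDiff_veronese.continuous

theorem exists_point_mem_closedBall (p : OP2) :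
    ∃ j, ∃ z ∈ Metric.closedBall (0 : Model) 1, point j z = p := by
  obtain ⟨i, w, rfl⟩ := exists_point p
  obtain ⟨j, hmax⟩ := Finite.exists_max fun k => ‖triple i w k‖
  have hj : 0 < ‖triple i w j‖ := by
    have h1 := hmax i
    rw [triple_self, norm_one] at h1
    exact zero_lt_one.trans_le h1
  have hle : ∀ k, ‖triple i w k * (triple i w j)⁻¹‖ ≤ 1 := fun k => by
    refine le_of_mul_le_mul_right ?_ hj
    rw [← norm_mul, mul_inv_mul _ (norm_pos_iff.1 hj), one_mul]
    exact hmax k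
  refine ⟨j, transition i j w, ?_, point_transition i j w (norm_pos_iff.1 hj)⟩
  rw [mem_closedBall_zero_iff, norm_prod_le_iff]
  unfold transition entries
  fin_cases j <;> exact ⟨hle _, hle _⟩

instance : CompactSpace OP2 := by
  have hcover : (⋃ j, point j '' Metric.closedBall 0 1) = Set.univ :=
    Set.eq_univ_of_forall fun p => Set.mem_iUnion.2 (exists_point_mem_closedBall p)
  refine ⟨hcover ▸ isCompact_iUnion fun j => ?_⟩
  exact (isCompact_closedBall 0 1).image (contMDiff_point j).continuous

theorem dense_setOf_triple_ne_zero (i j : Fin 3) : Dense {w : Model | triple i w j ≠ 0} := by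
  have := Module.punctured_nhds_neBot ℝ Octonion 0
  have hne : Dense ({0}ᶜ : Set Octonion) := dense_compl_singleton 0
  have hone : Dense {_w : Model | (1 : Octonion) ≠ 0} := by simp
  fin_cases i <;> fin_cases j <;>
    first | exact hone | exact hne.preimage isOpenMap_fst | exact hne.preimage isOpenMap_snd

theorem dense_affine (j : Fin 3) : Dense (affine j) := fun p => by
  obtain ⟨i, w, rfl⟩ := exists_point p
  exact map_mem_closure (contMDiff_point i).continuous (dense_setOf_triple_ne_zero i j w)
    fun z hz => (point_mem_affine_iff i j z).2 hz

theorem mem_range_veronese_of_dense {T : Herm → Herm} (hT : Continuous T) {s : Set OP2}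
    (hs : Dense s) (h : ∀ p ∈ s, T (veronese p) ∈ Set.range veronese) (p : OP2) :
    T (veronese p) ∈ Set.range veronese := by
  have hv := contMDiff_veronese.continuous
  have hclosed : IsClosed {q | T (veronese q) ∈ Set.range veronese} :=
    (isCompact_range hv).isClosed.preimage (hT.comp hv)
  exact hclosed.closure_subset_iff.2 h (hs p)

theorem dsSq_eq_hsNormSq_mfderiv_veronese {i : Fin 3} {p : OP2} (h : p ∈ affine i)
    (ξ : TangentSpace 𝓘(ℝ, Model) p) :
    dsSq i p ξ = hsNormSq (mfderiv 𝓘(ℝ, Model) 𝓘(ℝ, Herm) veronese p ξ) / 2 := by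
  have hproj := ((contDiff_projMatrix_triple i).differentiable (by simp)
    (affineEquiv i p)).hasFDerivAt.hasMFDerivAt
  have hchart := ((contMDiffAt_affineEquiv h).mdifferentiableAt (by simp)).hasMFDerivAt
  rw [((hproj.comp p hchart).congr_of_eventuallyEq (veronese_eventuallyEq h)).mfderiv,
    eq_div_iff two_ne_zero, mul_comm]
  exact (hsNormSq_fderiv_projMatrix_triple i _ _).symm

section Equivariant

variable {T : Herm →ₗ[ℝ] Herm} {F : OP2 → OP2} (hF : ∀ p, veronese (F p) = T (veronese p))
include hF

theorem contMDiff_of_veronese_eq : ContMDiff 𝓘(ℝ, Model) 𝓘(ℝ, Model) ω F := by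
  refine contMDiff_of_veronese_comp ?_
  rw [show veronese ∘ F = T.toContinuousLinearMap ∘ veronese from funext hF]
  exact T.toContinuousLinearMap.contDiff.contMDiff.comp contMDiff_veronese

theorem dsSq_mfderiv_of_veronese_eq (hT : ∀ X, hsNormSq (T X) = hsNormSq X) {p : OP2}
    {i j : Fin 3} (hi : p ∈ affine i) (hj : F p ∈ affine j) (ξ : TangentSpace 𝓘(ℝ, Model) p) :
    dsSq j (F p) (mfderiv 𝓘(ℝ, Model) 𝓘(ℝ, Model) F p ξ) = dsSq i p ξ := by
  have hcomm : veronese ∘ F = T.toContinuousLinearMap ∘ veronese := funext hF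
  have hleft := mfderiv_comp_apply p (contMDiff_veronese.mdifferentiableAt (by simp))
    ((contMDiff_of_veronese_eq hF).mdifferentiableAt (x := p) (by simp)) ξ
  have hright := mfderiv_comp_apply p
    (T.toContinuousLinearMap.contDiff (n := ω).contMDiff.mdifferentiableAt (by simp))
    (contMDiff_veronese.mdifferentiableAt (x := p) (by simp)) ξ
  rw [mfderiv_eq_fderiv, T.toContinuousLinearMap.fderiv] at hright
  rw [dsSq_eq_hsNormSq_mfderiv_veronese hi, dsSq_eq_hsNormSq_mfderiv_veronese hj, ← hleft, hcomm,
    hright]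
  exact congrArg (· / 2) (hT _)

end Equivariant

namespace IsIsometryOn

variable {f g : OP2 → OP2} {U V U' V' : Set OP2}

theorem univ_of_involutive (hf : ContMDiff 𝓘(ℝ, Model) 𝓘(ℝ, Model) ω f)
    (hinv : Function.Involutive f)
    (hds : ∀ (p : OP2) (i j : Fin 3), p ∈ affine i → f p ∈ affine j →
      ∀ ξ : TangentSpace 𝓘(ℝ, Model) p,
        dsSq j (f p) (mfderiv 𝓘(ℝ, Model) 𝓘(ℝ, Model) f p ξ) = dsSq i p ξ) :
    IsIsometryOn f Set.univ Set.univ where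
  isOpen_source := isOpen_univ
  isOpen_target := isOpen_univ
  bijOn := Set.bijOn_univ.2 hinv.bijective
  contMDiffOn := hf.contMDiffOn
  contMDiffOn_inverse := ⟨f, ⟨fun p _ => hinv p, fun p _ => hinv p⟩, hf.contMDiffOn⟩
  dsSq_map p _ := hds p

theorem restrict (hf : IsIsometryOn f U V) (hU' : IsOpen U') (hV' : IsOpen V') (hU : U' ⊆ U)
    (hbij : Set.BijOn f U' V') : IsIsometryOn f U' V' where
  isOpen_source := hU'
  isOpen_target := hV'
  bijOn := hbij
  contMDiffOn := hf.contMDiffOn.mono hU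
  contMDiffOn_inverse := by
    obtain ⟨g, hinv, hg⟩ := hf.contMDiffOn_inverse
    have hV : V' ⊆ V := by
      rw [← hbij.image_eq, ← hf.bijOn.image_eq]
      exact Set.image_mono hU
    exact ⟨g, hinv.mono hU hV, hg.mono hV⟩
  dsSq_map p hp := hf.dsSq_map p (hU hp)

theorem congr (hf : IsIsometryOn f U V) (h : Set.EqOn f g U) : IsIsometryOn g U V where
  isOpen_source := hf.isOpen_source
  isOpen_target := hf.isOpen_target
  bijOn := hf.bijOn.congr h
  contMDiffOn := hf.contMDiffOn.congr fun _ hp => (h hp).symm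
  contMDiffOn_inverse := by
    obtain ⟨k, hinv, hk⟩ := hf.contMDiffOn_inverse
    have hmaps := hinv.1.mapsTo hf.bijOn.surjOn
    exact ⟨k, ⟨hinv.1.congr_right h, hinv.2.congr_right hmaps h⟩, hk⟩
  dsSq_map p hp i j hi hj ξ := by
    have hgf : g =ᶠ[nhds p] f := by
      filter_upwards [hf.isOpen_source.mem_nhds hp] with q hq
      exact (h hq).symm
    have hj' : f p ∈ affine j := h hp ▸ hj
    rw [hgf.mfderiv_eq, ← h hp]
    exact hf.dsSq_map p hp i j hi hj' ξ

end IsIsometryOn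

/-- The map `X ↦ A X A` for the Hermitian matrix `A` with rows `(1, 0, 0)`, `(0, r, l)` and
`(0, l̄, -r)`, whose restriction to `𝕆P²` is the reflection. The products of three octonions are
written out so that no choice of bracketing is involved. -/
def hermReflection (r : ℝ) (l : Octonion) : Herm →ₗ[ℝ] Herm where
  toFun X :=
    (![X.1 0, r ^ 2 * X.1 1 + ‖l‖ ^ 2 * X.1 2 + 2 * r * inner ℝ l (X.2 1),
      ‖l‖ ^ 2 * X.1 1 + r ^ 2 * X.1 2 - 2 * r * inner ℝ l (X.2 1)],
    ![star (r • star (X.2 0) + l * X.2 2),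
      (r * (X.1 1 - X.1 2) + 2 * inner ℝ l (X.2 1)) • l - X.2 1,
      star l * star (X.2 0) - r • X.2 2])
  map_add' X Y := by
    refine Prod.ext (funext fun k => ?_) (funext fun k => ?_)
    · fin_cases k <;> simp [inner_add_right] <;> ring
    · fin_cases k <;> simp [inner_add_right, mul_add] <;> module
  map_smul' c X := by
    refine Prod.ext (funext fun k => ?_) (funext fun k => ?_)
    · fin_cases k <;> simp [real_inner_smul_right] <;> ring
    · fin_cases k <;> simp [real_inner_smul_right, mul_smul_comm] <;> module

theorem hermReflection_apply_fst_zero (r : ℝ) (l : Octonion) (X : Herm) :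
    (hermReflection r l X).1 0 = X.1 0 := rfl

section Reflection

variable {r : ℝ} {l : Octonion} (h : r ^ 2 + ‖l‖ ^ 2 = 1)
include h

theorem hsNormSq_hermReflection (X : Herm) : hsNormSq (hermReflection r l X) = hsNormSq X := by
  have hpair := norm_sq_smul_add_mul_add_norm_sq_star_mul_sub_smul h (star (X.2 0)) (X.2 2)
  rw [norm_star] at hpair
  have hl : ‖l‖ ^ 2 = 1 - r ^ 2 := by linear_combination h
  simp only [hsNormSq, Fin.sum_univ_three, hermReflection, LinearMap.coe_mk, AddHom.coe_mk,
    Matrix.cons_val, norm_star]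
  rw [norm_sub_sq_real, norm_smul, mul_pow, real_inner_smul_left, Real.norm_eq_abs, sq_abs, hl]
  linear_combination 2 * hpair

theorem hermReflection_outer (u v : Octonion) :
    hermReflection r l (outer (triple 0 (u, v))) =
      outer (triple 0 (r • u + l * v, star l * u - r • v)) := by
  refine Prod.ext (funext fun k => ?_) (funext fun k => ?_)
  · fin_cases k
    · rfl
    · exact (norm_sq_smul_add_mul r l u v).symm
    · exact (norm_sq_star_mul_sub_smul r l u v).symm
  · fin_cases k
    · simp [outer, triple, hermReflection]
    · exact (smul_add_mul_mul_star_star_mul_sub_smul h u v).symm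
    · simp [outer, triple, hermReflection]

theorem veronese_reflection {p : OP2} (hp : p ∈ affine 0) :
    veronese (reflection r l p) = hermReflection r l (veronese p) := by
  obtain ⟨⟨u, v⟩, rfl⟩ := hp
  rw [reflection_point, veronese_point, veronese_point, projMatrix, projMatrix, map_smul,
    hermReflection_outer h, normSq_triple, normSq_triple, add_assoc,
    norm_sq_smul_add_mul_add_norm_sq_star_mul_sub_smul h, ← add_assoc]

theorem reflection_reflection {p : OP2} (hp : p ∈ affine 0) :
    reflection r l (reflection r l p) = p := by
  obtain ⟨⟨u, v⟩, rfl⟩ := hp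
  rw [reflection_point, reflection_point]
  congr 2
  · rw [mul_sub, mul_star_mul, mul_smul_comm]
    linear_combination (norm := module) h • u
  · rw [mul_add, star_mul_mul, mul_smul_comm]
    linear_combination (norm := module) h • v

end Reflection

instance : Nonempty OP2 := ⟨point 0 0⟩

/-- The extension of `reflection r l` to `𝕆P²`: the point whose image under the Veronese embedding
is the image of `veronese p` under `hermReflection r l`. Such a point exists when
`r ^ 2 + ‖l‖ ^ 2 = 1`; otherwise the value can be junk. -/
def projReflection (r : ℝ) (l : Octonion) (p : OP2) : OP2 :=
  Function.invFun veronese (hermReflection r l (veronese p))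

section ProjReflection

variable {r : ℝ} {l : Octonion} (h : r ^ 2 + ‖l‖ ^ 2 = 1)
include h

theorem veronese_projReflection (p : OP2) :
    veronese (projReflection r l p) = hermReflection r l (veronese p) :=
  Function.invFun_eq <| mem_range_veronese_of_dense
    (hermReflection r l).continuous_of_finiteDimensional (dense_affine 0)
    (fun _ hq => ⟨_, veronese_reflection h hq⟩) p

theorem eqOn_projReflection : Set.EqOn (projReflection r l) (reflection r l) (affine 0) :=
  fun p hp => veronese_injective <| by rw [veronese_projReflection h, veronese_reflection h hp]

theorem contMDiff_projReflection :
    ContMDiff 𝓘(ℝ, Model) 𝓘(ℝ, Model) ω (projReflection r l) :=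
  contMDiff_of_veronese_eq (veronese_projReflection h)

theorem projReflection_mem_affine_zero_iff (p : OP2) :
    projReflection r l p ∈ affine 0 ↔ p ∈ affine 0 := by
  rw [← veronese_diag_ne_zero_iff, veronese_projReflection h, hermReflection_apply_fst_zero,
    veronese_diag_ne_zero_iff]

theorem involutive_projReflection : Function.Involutive (projReflection r l) := by
  have hcont := (contMDiff_projReflection h).continuous
  refine congrFun ((hcont.comp hcont).ext_on (dense_affine 0) continuous_id fun p hp => ?_)
  have hp' := (projReflection_mem_affine_zero_iff h p).2 hp
  rw [Function.comp_apply, eqOn_projReflection h hp', eqOn_projReflection h hp]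
  exact reflection_reflection h hp

theorem isIsometryOn_projReflection : IsIsometryOn (projReflection r l) Set.univ Set.univ :=
  .univ_of_involutive (contMDiff_projReflection h) (involutive_projReflection h)
    fun _ _ _ => dsSq_mfderiv_of_veronese_eq (veronese_projReflection h) (hsNormSq_hermReflection h)

theorem isIsometryOn_reflection : IsIsometryOn (reflection r l) (affine 0) (affine 0) := by
  have hinv := involutive_projReflection h
  have hmaps : Set.MapsTo (projReflection r l) (affine 0) (affine 0) :=
    fun p => (projReflection_mem_affine_zero_iff h p).2
  have hbij : Set.BijOn (projReflection r l) (affine 0) (affine 0) :=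
    Set.InvOn.bijOn ⟨fun p _ => hinv p, fun p _ => hinv p⟩ hmaps hmaps
  exact ((isIsometryOn_projReflection h).restrict (isOpen_affine 0) (isOpen_affine 0)
    (Set.subset_univ _) hbij).congr (eqOn_projReflection h)

end ProjReflection

end OP2

end

theorem mainTheorem8 (r : ℝ) (l : Octonion) (h : r ^ 2 + ‖l‖ ^ 2 = 1) :
    OP2.IsIsometryOn (OP2.reflection r l) (OP2.affine 0) (OP2.affine 0) ∧
      ∃ F : OP2 → OP2,
        ContMDiff 𝓘(ℝ, OP2.Model) 𝓘(ℝ, OP2.Model) ω F ∧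
        Set.EqOn F (OP2.reflection r l) (OP2.affine 0) ∧
        (∀ G : OP2 → OP2, ContMDiff 𝓘(ℝ, OP2.Model) 𝓘(ℝ, OP2.Model) ω G →
          Set.EqOn G (OP2.reflection r l) (OP2.affine 0) → G = F) ∧
        Function.Involutive F ∧
        OP2.IsIsometryOn F Set.univ Set.univ := by
  have hF := OP2.contMDiff_projReflection h
  have hext := OP2.eqOn_projReflection h
  refine ⟨OP2.isIsometryOn_reflection h, OP2.projReflection r l, hF, hext, fun G hG hGr => ?_,
    OP2.involutive_projReflection h, OP2.isIsometryOn_projReflection h⟩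
  exact hG.continuous.ext_on (OP2.dense_affine 0) hF.continuous (hGr.trans hext.symm)
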